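/- Equip the group $\mathcal H(2^{\mathbb N})$ of homeomorphisms of the Cantor set $2^{\mathbb N}$ with the topology of uniform convergence, and call $\sigma\in\mathcal H(2^{\mathbb N})$ generic if its conjugacy class is comeagre in $\mathcal H(2^{\mathbb N})$. For a homeomorphism $\rho$ of $2^{\mathbb N}$ write $(C(2^{\mathbb N}),\rho)$ for the C*-algebra of continuous functions $2^{\mathbb N}\to\mathbb C$ with the automorphism $f\mapsto f\circ\rho$, viewed as a structure of continuous logic in the language of unital C*-algebras with an additional unary function symbol for an automorphism. Let $\sigma$ be a generic homeomorphism of $2^{\mathbb N}$ and let $T=\operatorname{Th}((C(2^{\mathbb N}),\sigma))$. Then $T$ is not separably categorical: it is not true that any two separable models of $T$ are isomorphic. More precisely, there is a homeomorphism $\tau$ of $2^{\mathbb N}$ such that $(C(2^{\mathbb N}),\tau)$ is a model of $T$ and realizes a type (a set of formulas in finitely many variables) that is omitted in $(C(2^{\mathbb N}),\sigma)$; in particular $\tau$ is not topologically conjugate to $\sigma$. -/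

import Mathlib

noncomputable section

namespace CantorDynamics

/-! ### Homeomorphism groups and generic homeomorphisms -/

/-- The Cantor set `2^ℕ`. -/
abbrev Cantor : Type := ℕ → Bool

/-- The topology of the homeomorphism group of `X`: `f i` converges to `f` when both `f i → f` and
`(f i)⁻¹ → f⁻¹` in the compact-open topology. For compact Hausdorff `X` this is the topology of
uniform convergence (the clause on inverses is then automatic), equivalently the topology of
pointwise convergence of the induced automorphisms of `C(X)`. -/
instance homeoTopology (X : Type*) [TopologicalSpace X] : TopologicalSpace (X ≃ₜ X) :=
  TopologicalSpace.induced
    (fun f : X ≃ₜ X => ((f : C(X, X)), (f.symm : C(X, X)))) inferInstance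

/-- Topological conjugacy of two dynamical systems. -/
def TopConj {X Y : Type*} [TopologicalSpace X] [TopologicalSpace Y]
    (σ : X ≃ₜ X) (τ : Y ≃ₜ Y) : Prop :=
  ∃ h : X ≃ₜ Y, ∀ x, h (σ x) = τ (h x)

/-- A homeomorphism is generic if its conjugacy class is comeagre in the homeomorphism group. -/
def IsGeneric {X : Type*} [TopologicalSpace X] (σ : X ≃ₜ X) : Prop :=
  {τ : X ≃ₜ X | TopConj σ τ} ∈ residual (X ≃ₜ X)

/-- The automorphism `f ↦ f ∘ S` of `C(X)` induced by a homeomorphism `S` of `X`. -/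
def inducedAut {X : Type*} [TopologicalSpace X] (S : X ≃ₜ X) : C(X, ℂ) ≃⋆ₐ[ℂ] C(X, ℂ) :=
  S.compStarAlgEquiv' ℂ ℂ

theorem inducedAut_apply {X : Type*} [TopologicalSpace X] (S : X ≃ₜ X) (f : C(X, ℂ)) (x : X) :
    inducedAut S f x = f (S x) := rfl

/-! ### Continuous logic for unital C⋆-algebras with an automorphism

The language is that of unital C⋆-algebras together with a unary function symbol for an
automorphism. Its structures are the pairs `(A, α)` with `A` a unital C⋆-algebra and `α` a
⋆-automorphism of `A`; the domains of quantification are the closed balls around `0`. -/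

/-- Terms in `n` free variables: `⋆`-polynomials in which the automorphism may be applied. -/
inductive Term (n : ℕ) : Type
  | var : Fin n → Term n
  | one : Term n
  | add : Term n → Term n → Term n
  | mul : Term n → Term n → Term n
  | smul : ℂ → Term n → Term n
  | star : Term n → Term n
  | aut : Term n → Term n

/-- Formulas of continuous logic in `n` free variables: norms of terms, arbitrary continuous
real-valued connectives, and the quantifiers `sup` and `inf` over the closed ball of radius `r`,
which bind the last variable. -/
inductive Formula : ℕ → Type
  | norm {n : ℕ} (t : Term n) : Formula n
  | conn {n k : ℕ} (u : C(Fin k → ℝ, ℝ)) (φ : Fin k → Formula n) : Formula n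
  | sup {n : ℕ} (r : ℕ) (φ : Formula (n + 1)) : Formula n
  | inf {n : ℕ} (r : ℕ) (φ : Formula (n + 1)) : Formula n

/-- A sentence is a formula without free variables. -/
abbrev Sentence : Type := Formula 0

section Semantics

variable {A : Type*} [CStarAlgebra A] (α : A ≃⋆ₐ[ℂ] A)

/-- The interpretation of a term in `(A, α)`. -/
def Term.eval {n : ℕ} (v : Fin n → A) : Term n → A
  | .var i => v i
  | .one => 1
  | .add s t => s.eval v + t.eval v
  | .mul s t => s.eval v * t.eval v
  | .smul c t => c • t.eval v
  | .star t => Star.star (t.eval v)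
  | .aut t => α (t.eval v)

/-- The value of a formula in `(A, α)`. -/
def Formula.eval : {n : ℕ} → Formula n → (Fin n → A) → ℝ
  | _, .norm t, v => ‖t.eval α v‖
  | _, .conn u φ, v => u fun i => (φ i).eval v
  | _, .sup r φ, v => ⨆ x : Metric.closedBall (0 : A) r, φ.eval (Fin.snoc v (x : A))
  | _, .inf r φ, v => ⨅ x : Metric.closedBall (0 : A) r, φ.eval (Fin.snoc v (x : A))

/-- Terms are bounded on bounded sets. -/
theorem Term.exists_bound {n : ℕ} (t : Term n) (R : ℝ) :
    ∃ C : ℝ, ∀ v : Fin n → A, (∀ i, ‖v i‖ ≤ R) → ‖t.eval α v‖ ≤ C := by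
  induction t with
  | var i => exact ⟨R, fun v hv => hv i⟩
  | one => exact ⟨‖(1 : A)‖, fun v _ => le_rfl⟩
  | add s t hs ht =>
    obtain ⟨C, hC⟩ := hs
    obtain ⟨D, hD⟩ := ht
    exact ⟨C + D, fun v hv => (norm_add_le _ _).trans (add_le_add (hC v hv) (hD v hv))⟩
  | mul s t hs ht =>
    obtain ⟨C, hC⟩ := hs
    obtain ⟨D, hD⟩ := ht
    refine ⟨C * D, fun v hv => (norm_mul_le _ _).trans ?_⟩
    exact mul_le_mul (hC v hv) (hD v hv) (norm_nonneg _) ((norm_nonneg _).trans (hC v hv))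
  | smul c t ht =>
    obtain ⟨C, hC⟩ := ht
    refine ⟨‖c‖ * C, fun v hv => ?_⟩
    simp only [Term.eval, norm_smul]
    exact mul_le_mul_of_nonneg_left (hC v hv) (norm_nonneg _)
  | star t ht =>
    obtain ⟨C, hC⟩ := ht
    refine ⟨C, fun v hv => ?_⟩
    simp only [Term.eval, norm_star]
    exact hC v hv
  | aut t ht =>
    obtain ⟨C, hC⟩ := ht
    refine ⟨C, fun v hv => ?_⟩
    simp only [Term.eval]
    rw [NonUnitalStarAlgHom.norm_map α α.injective]
    exact hC v hv

/-- Formulas are bounded on bounded sets, so the suprema and infima in `Formula.eval` are taken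
over bounded non-empty sets of reals. -/
theorem Formula.exists_bound {n : ℕ} (φ : Formula n) (R : ℝ) :
    ∃ C : ℝ, ∀ v : Fin n → A, (∀ i, ‖v i‖ ≤ R) → |φ.eval α v| ≤ C := by
  have key : ∀ {n : ℕ} (r : ℕ) (R : ℝ) (v : Fin n → A) (x : Metric.closedBall (0 : A) r),
      (∀ i, ‖v i‖ ≤ R) → ∀ i, ‖(Fin.snoc v (x : A) : Fin (n + 1) → A) i‖ ≤ max R r := by
    intro n r R v x hv i
    refine Fin.lastCases ?_ (fun j => ?_) i
    · simpa using Or.inr (mem_closedBall_zero_iff.1 x.2)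
    · simpa using Or.inl (hv j)
  induction φ generalizing R with
  | norm t =>
    obtain ⟨C, hC⟩ := t.exists_bound α R
    exact ⟨C, fun v hv => by simpa [Formula.eval] using hC v hv⟩
  | conn u φ ih =>
    choose C hC using fun i => ih i R
    obtain ⟨D, hD⟩ := (isCompact_univ_pi fun i =>
      (isCompact_Icc : IsCompact (Set.Icc (-C i) (C i)))).exists_bound_of_continuousOn
        u.continuous.continuousOn
    exact ⟨D, fun v hv => hD _ fun i _ => abs_le.1 (hC i v hv)⟩
  | sup r φ ih =>
    obtain ⟨C, hC⟩ := ih (max R r)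
    refine ⟨C, fun v hv => ?_⟩
    have h := fun x => abs_le.1 (hC _ (key r R v x hv))
    have x₀ : Metric.closedBall (0 : A) (r : ℝ) := ⟨0, by simp⟩
    have : Nonempty (Metric.closedBall (0 : A) (r : ℝ)) := ⟨x₀⟩
    refine abs_le.2 ⟨(h x₀).1.trans ?_, ciSup_le fun x => (h x).2⟩
    exact le_ciSup (f := fun x : Metric.closedBall (0 : A) (r : ℝ) =>
      φ.eval α (Fin.snoc v (x : A))) ⟨C, by rintro _ ⟨x, rfl⟩; exact (h x).2⟩ x₀
  | inf r φ ih =>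
    obtain ⟨C, hC⟩ := ih (max R r)
    refine ⟨C, fun v hv => ?_⟩
    have h := fun x => abs_le.1 (hC _ (key r R v x hv))
    have x₀ : Metric.closedBall (0 : A) (r : ℝ) := ⟨0, by simp⟩
    have : Nonempty (Metric.closedBall (0 : A) (r : ℝ)) := ⟨x₀⟩
    refine abs_le.2 ⟨le_ciInf fun x => (h x).1, le_trans ?_ (h x₀).2⟩
    exact ciInf_le (f := fun x : Metric.closedBall (0 : A) (r : ℝ) =>
      φ.eval α (Fin.snoc v (x : A))) ⟨-C, by rintro _ ⟨x, rfl⟩; exact (h x).1⟩ x₀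

/-- `(A, α)` is a model of the set `T` of sentences if every sentence of `T` has value `0`. -/
def Models (T : Set Sentence) : Prop :=
  ∀ φ ∈ T, φ.eval α Fin.elim0 = 0

/-- The theory of `(A, α)`: all sentences with value `0`. Since `φ - r` is a sentence for every
sentence `φ` and real `r`, the theory determines the values of all sentences. -/
def theory : Set Sentence :=
  {φ | φ.eval α Fin.elim0 = 0}

/-- A tuple of `A` realizes the set `p` of formulas (a type in `n` variables) if every formula of
`p` has value `0` at it; `(A, α)` realizes `p` if one of its `n`-tuples does. -/
def Realizes {n : ℕ} (p : Set (Formula n)) : Prop :=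
  ∃ a : Fin n → A, ∀ φ ∈ p, φ.eval α a = 0

end Semantics

/-- Isomorphism of C⋆-algebras with an automorphism. -/
def Isomorphic {A B : Type*} [CStarAlgebra A] [CStarAlgebra B]
    (α : A ≃⋆ₐ[ℂ] A) (β : B ≃⋆ₐ[ℂ] B) : Prop :=
  ∃ Φ : A ≃⋆ₐ[ℂ] B, ∀ a, Φ (α a) = β (Φ a)

/-- A theory is separably categorical if any two separable models are isomorphic. (A separable
C⋆-algebra has at most continuum many elements, so up to isomorphism all separable models live in
the lowest universe.) -/
def SeparablyCategorical (T : Set Sentence) : Prop :=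
  ∀ (A B : Type) [CStarAlgebra A] [CStarAlgebra B]
    [TopologicalSpace.SeparableSpace A] [TopologicalSpace.SeparableSpace B]
    (α : A ≃⋆ₐ[ℂ] A) (β : B ≃⋆ₐ[ℂ] B),
    Models α T → Models β T → Isomorphic α β

end CantorDynamics

end

/-!
The pattern of a clopen labelling of a system records which finite orbit segments of labels occur
and, iteratively, which patterns its refinements have. As every continuous function on a
zero-dimensional compact space is uniformly approximated by functions of a finite clopen labelling,
a back-and-forth along patterns determines the value of each formula up to any `ε`; so systems with
the same patterns have the same theory.

If the conjugacy class of `σ` is dense, then for each `A ⊆ ℕ` and each `m` some clopen set has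
return times agreeing with `A` below `m`, since some clopen set of the full shift does and this is
an open condition on the homeomorphism. But the Cantor set has only countably many clopen sets, so
some `A` is not the full set of return times of any of them. A countable family of sequences of
clopen sets, closed under witnesses for patterns, has a limit along an ultrafilter; by Brouwer's
theorem this limit lives on the Cantor set. It has the patterns of `σ` and a clopen set with return
times exactly `A`, a property of a projection that is expressed by a type.
-/

noncomputable section

namespace CantorDynamics

open Set Filter Topology

theorem range_eq_range_iff {α β γ : Type*} {f : α → γ} {g : β → γ} :
    range f = range g ↔ (∀ a, ∃ b, f a = g b) ∧ ∀ b, ∃ a, f a = g b := by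
  simp only [Subset.antisymm_iff, range_subset_iff, mem_range]
  exact and_congr_left' (forall_congr' fun _ => exists_congr fun _ => eq_comm)

section SupInf

variable {ι κ : Type*} [Nonempty ι] [Nonempty κ] {f : ι → ℝ} {g : κ → ℝ} {ε : ℝ}

theorem abs_ciSup_sub_ciSup_le (hf : BddAbove (range f)) (hg : BddAbove (range g))
    (hfg : ∀ i, ∃ j, |f i - g j| ≤ ε) (hgf : ∀ j, ∃ i, |f i - g j| ≤ ε) :
    |(⨆ i, f i) - ⨆ j, g j| ≤ ε := by
  have hle : ⨆ i, f i ≤ (⨆ j, g j) + ε := ciSup_le fun i => by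
    obtain ⟨j, hj⟩ := hfg i
    linarith [abs_le.1 hj, le_ciSup hg j]
  have hge : ⨆ j, g j ≤ (⨆ i, f i) + ε := ciSup_le fun j => by
    obtain ⟨i, hi⟩ := hgf j
    linarith [abs_le.1 hi, le_ciSup hf i]
  exact abs_le.2 ⟨by linarith, by linarith⟩

theorem abs_ciInf_sub_ciInf_le (hf : BddBelow (range f)) (hg : BddBelow (range g))
    (hfg : ∀ i, ∃ j, |f i - g j| ≤ ε) (hgf : ∀ j, ∃ i, |f i - g j| ≤ ε) :
    |(⨅ i, f i) - ⨅ j, g j| ≤ ε := by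
  have hle : (⨅ i, f i) - ε ≤ ⨅ j, g j := le_ciInf fun j => by
    obtain ⟨i, hi⟩ := hgf j
    linarith [abs_le.1 hi, ciInf_le hf i]
  have hge : (⨅ j, g j) - ε ≤ ⨅ i, f i := le_ciInf fun i => by
    obtain ⟨j, hj⟩ := hfg i
    linarith [abs_le.1 hj, ciInf_le hg j]
  exact abs_le.2 ⟨by linarith, by linarith⟩

end SupInf

theorem exists_delta_of_continuous {E F : Type*} [SeminormedAddCommGroup E] [ProperSpace E]
    [SeminormedAddCommGroup F] {u : E → F} (hu : Continuous u) (C : ℝ) {ε : ℝ} (hε : 0 < ε) :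
    ∃ δ > 0, ∀ a b, ‖a‖ ≤ C → ‖b‖ ≤ C → ‖a - b‖ ≤ δ → ‖u a - u b‖ ≤ ε := by
  have huc := (isCompact_closedBall (0 : E) C).uniformContinuousOn_of_continuous hu.continuousOn
  obtain ⟨δ, hδ, h⟩ := Metric.uniformContinuousOn_iff_le.1 huc ε hε
  refine ⟨δ, hδ, fun a b ha hb hab => ?_⟩
  rw [← dist_eq_norm] at hab ⊢
  exact h a (mem_closedBall_zero_iff.2 ha) b (mem_closedBall_zero_iff.2 hb) hab

theorem exists_continuousMap_eq_true_iff {X : Type*} [TopologicalSpace X] {D : Set X}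
    (hD : IsClopen D) : ∃ Q : C(X, Bool), ∀ x, Q x = true ↔ x ∈ D :=
  ⟨⟨D.boolIndicator, (continuous_boolIndicator_iff_isClopen D).2 hD⟩, fun x =>
    (mem_iff_boolIndicator D x).symm⟩

section CompactTotallyDisconnected

variable {X : Type*} [TopologicalSpace X] [CompactSpace X]

theorem exists_labelling_of_isOpenCover [T2Space X] [TotallyDisconnectedSpace X] {V : Type*}
    [TopologicalSpace V] {O : V → TopologicalSpace.Opens X}
    (hO : TopologicalSpace.IsOpenCover O) : ∃ Q : C(X, V), ∀ x, x ∈ O (Q x) := by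
  obtain ⟨n, D, hD, hcover, hdisj⟩ := hO.exists_finite_nonempty_disjoint_clopen_cover
  choose label hlabel using fun j => (hD j).2
  choose piece hpiece using fun x => mem_iUnion.1 (hcover (mem_univ x))
  have hpiece_iff : ∀ x j, piece x = j ↔ x ∈ D j := fun x j =>
    ⟨fun h => h ▸ hpiece x, fun hx => hdisj.eq fun h =>
      (Set.disjoint_left.1 (TopologicalSpace.Clopens.coe_disjoint.2 h)) (hpiece x) hx⟩
  have hcont : Continuous piece := continuous_discrete_rng.2 fun j =>
    (show piece ⁻¹' {j} = D j from ext fun x => hpiece_iff x j) ▸ (D j).isOpen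
  exact ⟨⟨label ∘ piece, continuous_of_discreteTopology.comp hcont⟩, fun x =>
    hlabel _ (hpiece x)⟩

theorem exists_eq_comp_finite_tuple {J B V : Type*} [TopologicalSpace B] [T2Space B]
    [TopologicalSpace V] [DiscreteTopology V] [Nonempty V] {c : J → C(X, B)}
    (hc : ∀ x y, (∀ j, c j x = c j y) → x = y) (Q : C(X, V)) :
    ∃ (l : ℕ) (j : Fin l → J) (f : (Fin l → B) → V), ∀ x, Q x = f fun a => c (j a) x := by
  have hclosed : IsClosed {p : X × X | Q p.1 ≠ Q p.2} :=
    (isClopen_discrete {q : V × V | q.1 ≠ q.2}).isClosed.preimage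
      (by fun_prop : Continuous fun p : X × X => (Q p.1, Q p.2))
  obtain ⟨F, hF⟩ := hclosed.isCompact.elim_finite_subfamily_closed
    (fun j => {p : X × X | c j p.1 = c j p.2})
    (fun j => isClosed_eq (by fun_prop) (by fun_prop))
    (eq_empty_of_forall_notMem fun p hp => hp.1 (congrArg Q (hc _ _ (mem_iInter.1 hp.2))))
  let j : Fin F.card → J := fun a => F.equivFin.symm a
  obtain ⟨f, hf⟩ := (Function.factorsThrough_iff (f := fun x a => c (j a) x) Q).1 fun x y hxy => by
    refine by_contra fun hQ => eq_empty_iff_forall_notMem.1 hF (x, y) ⟨hQ, mem_iInter₂.2 ?_⟩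
    intro i hi
    simpa [j] using congrFun hxy (F.equivFin ⟨i, hi⟩)
  exact ⟨F.card, j, f, congrFun hf⟩

end CompactTotallyDisconnected

/-! ### Back-and-forth patterns -/

/-- Values of `pattern`. A `Pattern m d W` is a hereditarily finite code: for `d = 0` a set of words
of length `m` over the alphabet `W`, and for `d + 1` a set of codes over `W × Bool`. -/
def Pattern (m : ℕ) : ℕ → Type → Type
  | 0, W => Set (Fin m → W)
  | d + 1, W => Set (Pattern m d (W × Bool))

instance Pattern.finite (m d : ℕ) (W : Type) [Finite W] : Finite (Pattern m d W) := by
  induction d generalizing W with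
  | zero => exact inferInstanceAs (Finite (Set (Fin m → W)))
  | succ d ih =>
    have := ih (W × Bool)
    exact inferInstanceAs (Finite (Set (Pattern m d (W × Bool))))

section Pattern

variable {X Y : Type*} [TopologicalSpace X] [TopologicalSpace Y]

/-- The back-and-forth type of rank `d` of a labelling `P` of the system `(X, S)`: for `d = 0` the
set of words of length `m` read off along the orbits, and for `d + 1` the set of types of rank `d`
of the refinements of `P` by a clopen set. -/
def pattern (S : X ≃ₜ X) (m : ℕ) : (d : ℕ) → {W : Type} → (X → W) → Pattern m d W
  | 0, _, P => range fun (x : X) (i : Fin m) => P (S^[i] x)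
  | d + 1, _, P => range fun Q : C(X, Bool) => pattern S m d fun x => (P x, Q x)

variable {S : X ≃ₜ X} {T : Y ≃ₜ Y} {m d : ℕ} {W V : Type} {P : X → W} {P' : Y → W}

theorem pattern_zero_eq_iff :
    pattern S m 0 P = pattern T m 0 P' ↔
      (∀ x, ∃ y, ∀ i : Fin m, P (S^[i] x) = P' (T^[i] y)) ∧
      (∀ y, ∃ x, ∀ i : Fin m, P (S^[i] x) = P' (T^[i] y)) := by
  simp only [← funext_iff]
  exact range_eq_range_iff

theorem pattern_succ_eq_iff :
    pattern S m (d + 1) P = pattern T m (d + 1) P' ↔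
      (∀ Q : C(X, Bool), ∃ Q' : C(Y, Bool),
        pattern S m d (fun x => (P x, Q x)) = pattern T m d (fun y => (P' y, Q' y))) ∧
      (∀ Q' : C(Y, Bool), ∃ Q : C(X, Bool),
        pattern S m d (fun x => (P x, Q x)) = pattern T m d (fun y => (P' y, Q' y))) :=
  range_eq_range_iff

theorem pattern_comp (h : pattern S m d P = pattern T m d P') (f : W → V) :
    pattern S m d (fun x => f (P x)) = pattern T m d (fun y => f (P' y)) := by
  induction d generalizing W V with
  | zero =>
    rw [pattern_zero_eq_iff] at h ⊢
    exact h.imp (fun h x => (h x).imp fun _ hy i => congrArg f (hy i))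
      fun h y => (h y).imp fun _ hx i => congrArg f (hx i)
  | succ d ih =>
    rw [pattern_succ_eq_iff] at h ⊢
    exact h.imp (fun h Q => (h Q).imp fun _ hQ => ih hQ (Prod.map f id))
      fun h Q' => (h Q').imp fun _ hQ => ih hQ (Prod.map f id)

theorem pattern_eq_of_rank_le {d' : ℕ} (hd : d' ≤ d) (h : pattern S m d P = pattern T m d P') :
    pattern S m d' P = pattern T m d' P' := by
  induction d, hd using Nat.le_induction with
  | base => exact h
  | succ d _ ih =>
    obtain ⟨Q', hQ⟩ := (pattern_succ_eq_iff.1 h).1 (ContinuousMap.const X false)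
    exact ih (pattern_comp hQ Prod.fst)

theorem pattern_eq_of_length_le {m' : ℕ} (hm : m' ≤ m) (h : pattern S m d P = pattern T m d P') :
    pattern S m' d P = pattern T m' d P' := by
  induction d generalizing W with
  | zero =>
    rw [pattern_zero_eq_iff] at h ⊢
    exact h.imp (fun h x => (h x).imp fun _ hy i => hy (i.castLE hm))
      fun h y => (h y).imp fun _ hx i => hx (i.castLE hm)
  | succ d ih =>
    rw [pattern_succ_eq_iff] at h ⊢
    exact h.imp (fun h Q => (h Q).imp fun _ hQ => ih hQ) fun h Q' => (h Q').imp fun _ hQ => ih hQ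

theorem pattern_conj (g : X ≃ₜ Y) (hg : ∀ x, g (S x) = T (g x)) (P : Y → W) :
    pattern S m d (fun x => P (g x)) = pattern T m d P := by
  have hiterate : ∀ (i : ℕ) x, g (S^[i] x) = T^[i] (g x) := fun i x =>
    Function.Semiconj.iterate_right (f := g) hg i x
  induction d generalizing W with
  | zero =>
    simp only [pattern_zero_eq_iff, hiterate]
    exact ⟨fun x => ⟨g x, fun _ => rfl⟩, fun y => ⟨g.symm y, by simp⟩⟩
  | succ d ih =>
    rw [pattern_succ_eq_iff]
    refine ⟨fun Q => ⟨Q.comp (g.symm : C(Y, X)), ?_⟩, fun Q' => ⟨Q'.comp (g : C(X, Y)), ?_⟩⟩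
    · simpa using ih fun y => (P y, Q (g.symm y))
    · exact ih fun y => (P y, Q' y)

theorem exists_pattern_extension_bits (l : ℕ)
    (h : pattern S m (d + l) P = pattern T m (d + l) P') (Q : C(X, Fin l → Bool)) :
    ∃ Q' : C(Y, Fin l → Bool),
      pattern S m d (fun x => (P x, Q x)) = pattern T m d (fun y => (P' y, Q' y)) := by
  induction l generalizing W with
  | zero =>
    refine ⟨ContinuousMap.const Y default, ?_⟩
    simpa only [Subsingleton.elim _ (default : Fin 0 → Bool)] using
      pattern_comp (d := d) h fun w => (w, (default : Fin 0 → Bool))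
  | succ l ih =>
    obtain ⟨q, hq⟩ := ((pattern_succ_eq_iff (d := d + l)).1 h).1
      ⟨fun x => Q x (Fin.last l), by fun_prop⟩
    obtain ⟨Q', hQ⟩ := ih hq ⟨fun x i => Q x i.castSucc, by fun_prop⟩
    refine ⟨⟨fun y => Fin.snoc (Q' y) (q y), Q'.continuous.finSnoc q.continuous⟩, ?_⟩
    have hsnoc := pattern_comp hQ
      fun w => (w.1.1, (Fin.snoc w.2 w.1.2 : Fin (l + 1) → Bool))
    have hQsnoc : ∀ x, (Fin.snoc (fun i => Q x i.castSucc) (Q x (Fin.last l)) :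
        Fin (l + 1) → Bool) = Q x := fun x => Fin.snoc_init_self (Q x)
    simpa only [ContinuousMap.coe_mk, hQsnoc] using hsnoc

theorem exists_pattern_extension [Finite V] [Nonempty V] [TopologicalSpace V] [DiscreteTopology V]
    (h : pattern S m (d + Nat.card V) P = pattern T m (d + Nat.card V) P') (Q : C(X, V)) :
    ∃ Q' : C(Y, V),
      pattern S m d (fun x => (P x, Q x)) = pattern T m d (fun y => (P' y, Q' y)) := by
  let code : V → Fin (Nat.card V) → Bool := fun v i => decide (Finite.equivFin V v = i)
  have hcode : Function.Injective code := fun v w hvw => by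
    have := congrFun hvw (Finite.equivFin V v)
    simpa [code, eq_comm] using this
  obtain ⟨Q', hQ⟩ := exists_pattern_extension_bits _ h
    ⟨code ∘ Q, continuous_of_discreteTopology.comp Q.continuous⟩
  refine ⟨⟨Function.invFun code ∘ Q', continuous_of_discreteTopology.comp Q'.continuous⟩, ?_⟩
  simpa [Function.leftInverse_invFun hcode _] using
    pattern_comp hQ (Prod.map id (Function.invFun code))

end Pattern

/-! ### Patterns control the values of formulas -/

instance nonempty_closedBall {A : Type*} [SeminormedAddCommGroup A] (r : ℕ) :
    Nonempty (Metric.closedBall (0 : A) r) :=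
  ⟨⟨0, Metric.mem_closedBall_self r.cast_nonneg⟩⟩

theorem norm_snoc_le {A : Type*} [NormedAddCommGroup A] {n : ℕ} {v : Fin n → A} {a : A} {R r : ℝ}
    (hv : ∀ i, ‖v i‖ ≤ R) (ha : ‖a‖ ≤ r) (i : Fin (n + 1)) :
    ‖(Fin.snoc v a : Fin (n + 1) → A) i‖ ≤ max R r := by
  cases i using Fin.lastCases with
  | last => simpa using Or.inr ha
  | cast j => simpa using Or.inl (hv j)

theorem Formula.exists_bound_snoc {A : Type*} [CStarAlgebra A] (α : A ≃⋆ₐ[ℂ] A) {n : ℕ}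
    (φ : Formula (n + 1)) (v : Fin n → A) (r : ℝ) :
    ∃ C, ∀ a : Metric.closedBall (0 : A) r, |φ.eval α (Fin.snoc v (a : A))| ≤ C := by
  obtain ⟨C, hC⟩ := φ.exists_bound α (max ‖v‖ r)
  exact ⟨C, fun a => hC _ (norm_snoc_le (norm_le_pi_norm v) (mem_closedBall_zero_iff.1 a.2))⟩

section Control

variable {X Y : Type*} [TopologicalSpace X] [CompactSpace X] [TopologicalSpace Y] [CompactSpace Y]

theorem abs_norm_sub_norm_le_of_forall_exists {f : C(X, ℂ)} {g : C(Y, ℂ)} {ε : ℝ} (hε : 0 ≤ ε)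
    (hfg : ∀ x, ∃ y, ‖f x - g y‖ ≤ ε) (hgf : ∀ y, ∃ x, ‖f x - g y‖ ≤ ε) :
    |‖f‖ - ‖g‖| ≤ ε := by
  have hle : ‖f‖ ≤ ‖g‖ + ε := (ContinuousMap.norm_le _ (by positivity)).2 fun x => by
    obtain ⟨y, hy⟩ := hfg x
    linarith [norm_le_norm_add_norm_sub' (f x) (g y), g.norm_coe_le_norm y]
  have hge : ‖g‖ ≤ ‖f‖ + ε := (ContinuousMap.norm_le _ (by positivity)).2 fun y => by
    obtain ⟨x, hx⟩ := hgf y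
    linarith [norm_le_norm_add_norm_sub (f x) (g y), f.norm_coe_le_norm x]
  exact abs_le.2 ⟨by linarith, by linarith⟩

theorem Term.exists_common_bound (S : X ≃ₜ X) (T : Y ≃ₜ Y) {n : ℕ} (t : Term n) (R : ℝ) :
    ∃ C, (∀ v : Fin n → C(X, ℂ), (∀ i, ‖v i‖ ≤ R) → ∀ x, ‖t.eval (inducedAut S) v x‖ ≤ C) ∧
      ∀ v : Fin n → C(Y, ℂ), (∀ i, ‖v i‖ ≤ R) → ∀ y, ‖t.eval (inducedAut T) v y‖ ≤ C := by
  obtain ⟨C, hC⟩ := t.exists_bound (inducedAut S) R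
  obtain ⟨D, hD⟩ := t.exists_bound (inducedAut T) R
  exact ⟨max C D,
    fun v hv x => (ContinuousMap.norm_coe_le_norm _ x).trans ((hC v hv).trans (le_max_left _ _)),
    fun v hv y => (ContinuousMap.norm_coe_le_norm _ y).trans ((hD v hv).trans (le_max_right _ _))⟩

theorem Term.eventually_norm_eval_sub_le (S : X ≃ₜ X) (T : Y ≃ₜ Y) {n : ℕ} (t : Term n) (R : ℝ)
    {ε : ℝ} (hε : 0 < ε) :
    ∀ᶠ N : ℕ in atTop, ∀ (v : Fin n → C(X, ℂ)) (v' : Fin n → C(Y, ℂ)),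
      (∀ i, ‖v i‖ ≤ R) → (∀ i, ‖v' i‖ ≤ R) → ∀ x y,
      (∀ i, ∀ k < N, ‖v i (S^[k] x) - v' i (T^[k] y)‖ ≤ 1 / (N + 1)) →
      ‖t.eval (inducedAut S) v x - t.eval (inducedAut T) v' y‖ ≤ ε := by
  induction t generalizing ε with
  | var i =>
    filter_upwards [eventually_gt_atTop 0,
      tendsto_one_div_add_atTop_nhds_zero_nat.eventually_lt_const hε] with N hN hNε v v' _ _ x y h
    exact (h i 0 hN).trans hNε.le
  | one => exact .of_forall fun N v v' _ _ x y _ => by simpa [Term.eval] using hε.le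
  | add s t hs ht =>
    filter_upwards [hs (half_pos hε), ht (half_pos hε)] with N hs ht v v' hv hv' x y h
    simp only [Term.eval, ContinuousMap.add_apply, add_sub_add_comm]
    exact (norm_add_le_of_le (hs v v' hv hv' x y h) (ht v v' hv hv' x y h)).trans (by linarith)
  | mul s t hs ht =>
    obtain ⟨C, hCS, hCT⟩ := s.exists_common_bound S T R
    obtain ⟨D, hDS, hDT⟩ := t.exists_common_bound S T R
    obtain ⟨δ, hδ, hmul⟩ := exists_delta_of_continuous
      (continuous_mul : Continuous fun p : ℂ × ℂ => p.1 * p.2) (max C D) hε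
    filter_upwards [hs hδ, ht hδ] with N hs ht v v' hv hv' x y h
    exact hmul (_, _) (_, _) (max_le_max (hCS v hv x) (hDS v hv x))
      (max_le_max (hCT v' hv' y) (hDT v' hv' y)) (max_le (hs v v' hv hv' x y h)
        (ht v v' hv hv' x y h))
  | smul c t ht =>
    filter_upwards [ht (show 0 < ε / (‖c‖ + 1) by positivity)] with N ht v v' hv hv' x y h
    simp only [Term.eval, ContinuousMap.smul_apply, ← smul_sub, norm_smul]
    calc ‖c‖ * _ ≤ (‖c‖ + 1) * (ε / (‖c‖ + 1)) := by
          gcongr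
          · linarith
          · exact ht v v' hv hv' x y h
      _ = ε := mul_div_cancel₀ ε (by positivity)
  | star t ht =>
    filter_upwards [ht hε] with N ht v v' hv hv' x y h
    simpa only [Term.eval, ContinuousMap.star_apply, ← star_sub, norm_star] using
      ht v v' hv hv' x y h
  | aut t ht =>
    filter_upwards [(tendsto_sub_atTop_nat 1).eventually (ht hε), eventually_gt_atTop 0]
      with N ht hN v v' hv hv' x y h
    refine ht v v' hv hv' (S x) (T y) fun i k hk => (h i (k + 1) (by omega)).trans ?_
    gcongr
    exact N.sub_le 1

/-- At precision `N`, back-and-forth patterns control `φ` up to `ε` on the ball of radius `R`: two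
tuples which agree up to `1 / (N + 1)` on equally labelled points, for labellings with equal
patterns, give `φ` values at distance at most `ε`. -/
def Formula.ControlledAt (S : X ≃ₜ X) (T : Y ≃ₜ Y) {n : ℕ} (φ : Formula n) (R ε : ℝ) (N : ℕ) :
    Prop :=
  ∀ {W : Type} {P : X → W} {P' : Y → W} {v : Fin n → C(X, ℂ)} {v' : Fin n → C(Y, ℂ)},
    (∀ i, ‖v i‖ ≤ R) → (∀ i, ‖v' i‖ ≤ R) →
    (∀ i x y, P x = P' y → ‖v i x - v' i y‖ ≤ 1 / (N + 1)) →
    pattern S N N P = pattern T N N P' →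
    |φ.eval (inducedAut S) v - φ.eval (inducedAut T) v'| ≤ ε

theorem Formula.ControlledAt.symm {S : X ≃ₜ X} {T : Y ≃ₜ Y} {n : ℕ} {φ : Formula n} {R ε : ℝ}
    {N : ℕ} (h : φ.ControlledAt S T R ε N) : φ.ControlledAt T S R ε N := by
  intro W P P' v v' hv hv' hclose hpat
  rw [abs_sub_comm]
  exact h hv' hv (fun i x y hxy => by rw [norm_sub_rev]; exact hclose i y x hxy.symm) hpat.symm

theorem Formula.eventually_controlledAt_norm (S : X ≃ₜ X) (T : Y ≃ₜ Y) {n : ℕ} (t : Term n)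
    (R : ℝ) {ε : ℝ} (hε : 0 < ε) : ∀ᶠ N in atTop, (Formula.norm t).ControlledAt S T R ε N := by
  filter_upwards [t.eventually_norm_eval_sub_le S T R hε]
    with N ht W P P' v v' hv hv' hclose hpat
  have hwords := pattern_zero_eq_iff.1 (pattern_eq_of_rank_le N.zero_le hpat)
  have heval : ∀ x y, (∀ k : Fin N, P (S^[k] x) = P' (T^[k] y)) →
      ‖t.eval (inducedAut S) v x - t.eval (inducedAut T) v' y‖ ≤ ε := fun x y hxy =>
    ht v v' hv hv' x y fun i k hk => hclose i _ _ (hxy ⟨k, hk⟩)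
  exact abs_norm_sub_norm_le_of_forall_exists hε.le
    (fun x => (hwords.1 x).imp fun y => heval x y) fun y => (hwords.2 y).imp fun x => heval x y

theorem Formula.eventually_controlledAt_conn {S : X ≃ₜ X} {T : Y ≃ₜ Y} {n k : ℕ}
    (u : C(Fin k → ℝ, ℝ)) {φ : Fin k → Formula n} {R : ℝ}
    (hφ : ∀ i, ∀ ε > 0, ∀ᶠ N in atTop, (φ i).ControlledAt S T R ε N) {ε : ℝ} (hε : 0 < ε) :
    ∀ᶠ N in atTop, (Formula.conn u φ).ControlledAt S T R ε N := by
  choose C hC using fun i => (φ i).exists_bound (inducedAut S) R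
  choose D hD using fun i => (φ i).exists_bound (inducedAut T) R
  obtain ⟨δ, hδ, hu⟩ := exists_delta_of_continuous u.continuous (max ‖C‖ ‖D‖) hε
  filter_upwards [eventually_all.2 fun i => hφ i δ hδ] with N hN W P P' v v' hv hv' hclose hpat
  have hbound : ∀ {a c : Fin k → ℝ}, (∀ i, |a i| ≤ c i) → ‖a‖ ≤ ‖c‖ := fun {a c} h =>
    (pi_norm_le_iff_of_nonneg (norm_nonneg c)).2 fun i =>
      ((h i).trans (le_abs_self _)).trans (norm_le_pi_norm c i)
  exact hu _ _ ((hbound fun i => hC i v hv).trans (le_max_left _ _))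
    ((hbound fun i => hD i v' hv').trans (le_max_right _ _))
    ((pi_norm_le_iff_of_nonneg hδ.le).2 fun i => hN i hv hv' hclose hpat)

theorem exists_pattern_response [T2Space X] [TotallyDisconnectedSpace X] {S : X ≃ₜ X} {T : Y ≃ₜ Y}
    {m d : ℕ} {W : Type} {P : X → W} {P' : Y → W} {r δ : ℝ} (hr : 0 ≤ r) {t : Set ℂ} [Finite t]
    (hsub : t ⊆ Metric.closedBall 0 r) (hcover : Metric.closedBall 0 r ⊆ ⋃ z ∈ t, Metric.ball z δ)
    (h : pattern S m (d + Nat.card t) P = pattern T m (d + Nat.card t) P') {g : C(X, ℂ)}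
    (hg : ‖g‖ ≤ r) :
    ∃ g' : C(Y, ℂ), ‖g'‖ ≤ r ∧ ∃ (Q : X → t) (Q' : Y → t),
      pattern S m d (fun x => (P x, Q x)) = pattern T m d (fun y => (P' y, Q' y)) ∧
      ∀ x y, Q x = Q' y → ‖g x - g' y‖ ≤ δ := by
  have hnet : ∀ z ∈ Metric.closedBall (0 : ℂ) r, ∃ w : t, z ∈ Metric.ball (w : ℂ) δ := fun z hz =>
    let ⟨w, hw, hzw⟩ := mem_iUnion₂.1 (hcover hz)
    ⟨⟨w, hw⟩, hzw⟩
  have : Nonempty t := (hnet 0 (Metric.mem_closedBall_self hr)).nonempty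
  obtain ⟨Q, hQ⟩ := exists_labelling_of_isOpenCover
    (O := fun w : t => ⟨g ⁻¹' Metric.ball w δ, Metric.isOpen_ball.preimage g.continuous⟩)
    (.of_sets _ (eq_univ_of_forall fun x => mem_iUnion.2
      (hnet (g x) (mem_closedBall_zero_iff.2 ((g.norm_coe_le_norm x).trans hg)))))
  obtain ⟨Q', hQ'⟩ := exists_pattern_extension h Q
  refine ⟨⟨fun y => Q' y, by fun_prop⟩, ?_, Q, Q', hQ', fun x y hxy => ?_⟩
  · exact (ContinuousMap.norm_le _ hr).2 fun y => mem_closedBall_zero_iff.1 (hsub (Q' y).2)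
  · have hgQ : dist (g x) (Q x) < δ := hQ x
    rw [hxy, dist_eq_norm] at hgQ
    exact hgQ.le

theorem Formula.ControlledAt.exists_response [T2Space X] [TotallyDisconnectedSpace X] {S : X ≃ₜ X}
    {T : Y ≃ₜ Y} {n : ℕ} {φ : Formula (n + 1)} {r : ℕ} {R ε : ℝ} {M N : ℕ}
    (hφ : φ.ControlledAt S T (max R r) ε M) {t : Set ℂ} [Finite t]
    (hsub : t ⊆ Metric.closedBall 0 r)
    (hcover : Metric.closedBall 0 (r : ℝ) ⊆ ⋃ z ∈ t, Metric.ball z (1 / (M + 1)))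
    (hN : M + Nat.card t ≤ N) {W : Type} {P : X → W} {P' : Y → W} {v : Fin n → C(X, ℂ)}
    {v' : Fin n → C(Y, ℂ)} (hv : ∀ i, ‖v i‖ ≤ R) (hv' : ∀ i, ‖v' i‖ ≤ R)
    (hclose : ∀ i x y, P x = P' y → ‖v i x - v' i y‖ ≤ 1 / (N + 1))
    (hpat : pattern S N N P = pattern T N N P') (g : Metric.closedBall (0 : C(X, ℂ)) r) :
    ∃ g' : Metric.closedBall (0 : C(Y, ℂ)) r,
      |φ.eval (inducedAut S) (Fin.snoc v (g : C(X, ℂ))) -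
        φ.eval (inducedAut T) (Fin.snoc v' (g' : C(Y, ℂ)))| ≤ ε := by
  have hMN : M ≤ N := (Nat.le_add_right _ _).trans hN
  have hg := mem_closedBall_zero_iff.1 g.2
  obtain ⟨g', hg', Q, Q', hQ, hQclose⟩ := exists_pattern_response r.cast_nonneg hsub hcover
    (pattern_eq_of_rank_le hN (pattern_eq_of_length_le hMN hpat)) hg
  refine ⟨⟨g', mem_closedBall_zero_iff.2 hg'⟩, hφ (norm_snoc_le hv hg) (norm_snoc_le hv' hg')
    (fun i x y hxy => ?_) hQ⟩
  obtain ⟨hP, hQxy⟩ := Prod.mk.inj hxy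
  cases i using Fin.lastCases with
  | last => simpa only [Fin.snoc_last] using hQclose x y hQxy
  | cast j =>
    simp only [Fin.snoc_castSucc]
    exact (hclose j x y hP).trans (by gcongr)

variable [T2Space X] [TotallyDisconnectedSpace X] [T2Space Y] [TotallyDisconnectedSpace Y]

theorem Formula.ControlledAt.eventually_responses {S : X ≃ₜ X} {T : Y ≃ₜ Y} {n : ℕ}
    {φ : Formula (n + 1)} {r : ℕ} {R ε : ℝ} {M : ℕ} (hφ : φ.ControlledAt S T (max R r) ε M) :
    ∀ᶠ N : ℕ in atTop, ∀ {W : Type} {P : X → W} {P' : Y → W} {v : Fin n → C(X, ℂ)}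
      {v' : Fin n → C(Y, ℂ)}, (∀ i, ‖v i‖ ≤ R) → (∀ i, ‖v' i‖ ≤ R) →
      (∀ i x y, P x = P' y → ‖v i x - v' i y‖ ≤ 1 / (N + 1)) →
      pattern S N N P = pattern T N N P' →
      let gap (g : Metric.closedBall (0 : C(X, ℂ)) r) (g' : Metric.closedBall (0 : C(Y, ℂ)) r) :=
        |φ.eval (inducedAut S) (Fin.snoc v (g : C(X, ℂ))) -
          φ.eval (inducedAut T) (Fin.snoc v' (g' : C(Y, ℂ)))|
      (∀ g, ∃ g', gap g g' ≤ ε) ∧ ∀ g', ∃ g, gap g g' ≤ ε := by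
  obtain ⟨t, hsub, ht, hcover⟩ := (isCompact_closedBall (0 : ℂ) r).finite_cover_balls
    (Nat.one_div_pos_of_nat (n := M))
  have := ht.to_subtype
  filter_upwards [eventually_ge_atTop (M + Nat.card t)]
    with N hN W P P' v v' hv hv' hclose hpat
  refine ⟨hφ.exists_response hsub hcover hN hv hv' hclose hpat, fun g' => ?_⟩
  have hφ' : φ.ControlledAt T S (max R r) ε M := hφ.symm
  obtain ⟨g, hg⟩ := hφ'.exists_response hsub hcover hN hv' hv
    (fun i x y hxy => by rw [norm_sub_rev]; exact hclose i y x hxy.symm) hpat.symm g'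
  exact ⟨g, (abs_sub_comm _ _).trans_le hg⟩

theorem Formula.eventually_controlledAt (S : X ≃ₜ X) (T : Y ≃ₜ Y) {n : ℕ} (φ : Formula n) (R : ℝ)
    {ε : ℝ} (hε : 0 < ε) : ∀ᶠ N in atTop, φ.ControlledAt S T R ε N := by
  induction φ generalizing R ε with
  | norm t => exact eventually_controlledAt_norm S T t R hε
  | conn u φ ih => exact eventually_controlledAt_conn u (fun i ε hε => ih i R hε) hε
  | sup r φ ih =>
    obtain ⟨M, hM⟩ := (ih (max R r) hε).exists
    filter_upwards [hM.eventually_responses] with N hN W P P' v v' hv hv' hclose hpat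
    obtain ⟨C, hC⟩ := φ.exists_bound_snoc (inducedAut S) v r
    obtain ⟨D, hD⟩ := φ.exists_bound_snoc (inducedAut T) v' r
    have h := hN hv hv' hclose hpat
    exact abs_ciSup_sub_ciSup_le ⟨C, forall_mem_range.2 fun g => (abs_le.1 (hC g)).2⟩
      ⟨D, forall_mem_range.2 fun g => (abs_le.1 (hD g)).2⟩ h.1 h.2
  | inf r φ ih =>
    obtain ⟨M, hM⟩ := (ih (max R r) hε).exists
    filter_upwards [hM.eventually_responses] with N hN W P P' v v' hv hv' hclose hpat
    obtain ⟨C, hC⟩ := φ.exists_bound_snoc (inducedAut S) v r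
    obtain ⟨D, hD⟩ := φ.exists_bound_snoc (inducedAut T) v' r
    have h := hN hv hv' hclose hpat
    exact abs_ciInf_sub_ciInf_le ⟨-C, forall_mem_range.2 fun g => (abs_le.1 (hC g)).1⟩
      ⟨-D, forall_mem_range.2 fun g => (abs_le.1 (hD g)).1⟩ h.1 h.2

theorem models_theory_of_pattern_eq {S : X ≃ₜ X} {T : Y ≃ₜ Y}
    (h : ∀ N, pattern S N N (fun _ => ()) = pattern T N N fun _ => ()) :
    Models (inducedAut T) (theory (inducedAut S)) := by
  intro φ hφ
  refine abs_nonpos_iff.1 (le_of_forall_pos_le_add fun ε hε => ?_)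
  obtain ⟨N, hN⟩ := (φ.eventually_controlledAt S T 0 hε).exists
  have hle := hN (v := Fin.elim0) (v' := Fin.elim0) Fin.rec0 Fin.rec0 Fin.rec0 (h N)
  have hφ0 : φ.eval (inducedAut S) Fin.elim0 = 0 := hφ
  rwa [hφ0, zero_sub, abs_neg, ← zero_add ε] at hle

end Control

/-! ### Limits of systems along an ultrafilter -/

theorem exists_countable_closed {α : Type*} {F : ℕ → Type*} [∀ k, Countable (F k)]
    (op : ∀ k, F k → (Fin k → α) → α) (a : α) :
    ∃ J : Set α, J.Countable ∧ a ∈ J ∧ ∀ k (f : F k) v, (∀ i, v i ∈ J) → op k f v ∈ J := by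
  let L : FirstOrder.Language := ⟨F, fun _ => Empty⟩
  let _ : L.Structure α := { funMap := fun {k} f v => op k f v, RelMap := fun r => r.elim }
  have : Countable (Σ k, L.Functions k) := inferInstanceAs (Countable (Σ k, F k))
  let J := FirstOrder.Language.Substructure.closure L {a}
  exact ⟨J, (countable_singleton a).substructure_closure (L := L),
    FirstOrder.Language.Substructure.subset_closure rfl, fun _ f => J.fun_mem f⟩

theorem eventually_iff_of_imp {ι : Type*} {l : Filter ι} {p : ι → Prop} {q : Prop}
    (hp : q → ∀ᶠ i in l, p i) (hq : ¬ q → ∀ᶠ i in l, ¬ p i) : ∀ᶠ i in l, (p i ↔ q) := by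
  by_cases h : q
  · exact (hp h).mono fun _ hi => iff_of_true hi h
  · exact (hq h).mono fun _ hi => iff_of_false hi h

section Limit

variable {ι : Type*} (U : Ultrafilter ι) {J : Type*} {X : ι → Type*} [∀ i, TopologicalSpace (X i)]
  (e : ∀ i, J → C(X i, Bool))

/-- The limit along `U` of the images of the spaces `X i` in `2^J` under the maps `e i`, regarded
as subsets of `2^J`: the points of `2^J` each of whose finite restrictions is attained on `X i` for
almost all `i`. -/
def limitSpace : Set (J → Bool) :=
  {y | ∀ F : Finset J, ∀ᶠ i in (U : Filter ι), ∃ x, ∀ j : F, e i j x = y j}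

theorem isClosed_limitSpace : IsClosed (limitSpace U e) := by
  simp only [limitSpace, ofPred_forall]
  exact isClosed_iInter fun F => (isClosed_discrete
    {z : F → Bool | ∀ᶠ i in (U : Filter ι), ∃ x, ∀ j : F, e i j x = z j}).preimage
      (by fun_prop : Continuous fun (y : J → Bool) (j : F) => y j)

instance : CompactSpace (limitSpace U e) :=
  isCompact_iff_compactSpace.1 (isClosed_limitSpace U e).isCompact

variable {U e}

theorem eventually_exists_of_mem_limitSpace {y : J → Bool} (hy : y ∈ limitSpace U e) {κ : Type*}
    [Finite κ] (j : κ → J) : ∀ᶠ i in (U : Filter ι), ∃ x, ∀ a, e i (j a) x = y (j a) :=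
  (hy (finite_range j).toFinset).mono fun _ hi =>
    hi.imp fun _ hx a => hx ⟨j a, by simp⟩

theorem exists_mem_limitSpace_iff {κ : Type*} [Finite κ] (j : κ → J) (z : κ → Bool) :
    (∃ y : limitSpace U e, ∀ a, y.1 (j a) = z a) ↔
      ∀ᶠ i in (U : Filter ι), ∃ x, ∀ a, e i (j a) x = z a := by
  refine ⟨fun ⟨y, hy⟩ => ?_, fun h => ?_⟩
  · simpa only [hy] using eventually_exists_of_mem_limitSpace y.2 j
  have hne : ∀ᶠ i in (U : Filter ι), ∃ w : J → Bool,
      (∃ x, ∀ j, e i j x = w j) ∧ ∀ a, w (j a) = z a :=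
    h.mono fun i ⟨x, hx⟩ => ⟨fun j => e i j x, ⟨x, fun _ => rfl⟩, hx⟩
  obtain ⟨w, hw⟩ := hne.choice
  obtain ⟨y, -, hy⟩ := isCompact_univ.ultrafilter_le_nhds (U.map w) (by simp)
  have hwy : ∀ j, ∀ᶠ i in (U : Filter ι), w i j = y j := fun j => by
    simpa [nhds_discrete] using tendsto_pi_nhds.1 (show Tendsto w U (𝓝 y) from hy) j
  refine ⟨⟨y, fun F => ?_⟩, fun a => ?_⟩
  · filter_upwards [hw, eventually_all.2 fun j : F => hwy j] with i ⟨⟨x, hx⟩, _⟩ hi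
    exact ⟨x, fun j => (hx j).trans (hi j)⟩
  · obtain ⟨i, hi, hia⟩ := (hw.and (hwy (j a))).exists
    exact hia.symm.trans (hi.2 a)

variable {S : ∀ i, X i ≃ₜ X i} {s : J ≃ J}

theorem comp_mem_limitSpace (hs : ∀ i j x, e i (s j) x = e i j (S i x)) {y : J → Bool}
    (hy : y ∈ limitSpace U e) : y ∘ s ∈ limitSpace U e := fun F =>
  (eventually_exists_of_mem_limitSpace hy fun j : F => s j).mono fun i ⟨x, hx⟩ =>
    ⟨S i x, fun j => (hs i j x).symm.trans (hx j)⟩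

theorem apply_symm_index (hs : ∀ i j x, e i (s j) x = e i j (S i x)) (i : ι) (j : J) (x : X i) :
    e i (s.symm j) x = e i j ((S i).symm x) := by
  simpa using (hs i (s.symm j) ((S i).symm x)).symm

theorem apply_iterate_index (hs : ∀ i j x, e i (s j) x = e i j (S i x)) (i : ι) (p : ℕ) (j : J)
    (x : X i) : e i (s^[p] j) x = e i j ((S i)^[p] x) := by
  induction p generalizing x with
  | zero => rfl
  | succ p ih => rw [Function.iterate_succ_apply', hs, ih, Function.iterate_succ_apply]

variable (U) in
/-- The homeomorphism of the limit space induced by the homeomorphisms `S i`, which are assumed to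
act on the coordinates by the permutation `s`. -/
def limitHomeo (hs : ∀ i j x, e i (s j) x = e i j (S i x)) :
    limitSpace U e ≃ₜ limitSpace U e where
  toFun y := ⟨y.1 ∘ s, comp_mem_limitSpace hs y.2⟩
  invFun y := ⟨y.1 ∘ s.symm, comp_mem_limitSpace (apply_symm_index hs) y.2⟩
  left_inv y := Subtype.ext (by simp [Function.comp_assoc])
  right_inv y := Subtype.ext (by simp [Function.comp_assoc])
  continuous_toFun := ((Pi.continuous_precomp s).comp continuous_subtype_val).subtype_mk _
  continuous_invFun := ((Pi.continuous_precomp s.symm).comp continuous_subtype_val).subtype_mk _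

theorem limitHomeo_iterate_apply (hs : ∀ i j x, e i (s j) x = e i j (S i x)) (p : ℕ)
    (y : limitSpace U e) (j : J) : ((limitHomeo U hs)^[p] y).1 j = y.1 (s^[p] j) := by
  induction p generalizing y with
  | zero => rfl
  | succ p ih =>
    rw [Function.iterate_succ_apply, ih, Function.iterate_succ_apply']
    rfl

variable (S e) in
/-- The Tarski–Vaught condition for the clopen sets coded by `J`: whatever pattern a clopen set can
form over finitely many of them is also formed by one of them, with the same index for all `i`. -/
def HasWitnesses : Prop :=
  ∀ (k m d : ℕ) (j : Fin k → J) (t : Pattern m d ((Fin k → Bool) × Bool)), ∃ b, ∀ i,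
    (∃ Q : C(X i, Bool), pattern (S i) m d (fun x => (fun a => e i (j a) x, Q x)) = t) →
      pattern (S i) m d (fun x => (fun a => e i (j a) x, e i b x)) = t

theorem eventually_pattern_zero_eq (hs : ∀ i j x, e i (s j) x = e i j (S i x)) (m : ℕ) {k : ℕ}
    (j : Fin k → J) : ∀ᶠ i in (U : Filter ι), pattern (S i) m 0 (fun x a => e i (j a) x) =
      pattern (limitHomeo U hs) m 0 (fun y a => y.1 (j a)) := by
  have hword : ∀ w : Fin m → Fin k → Bool,
      (∃ y, (fun p : Fin m => fun a => ((limitHomeo U hs)^[p] y).1 (j a)) = w) ↔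
        ∀ᶠ i in (U : Filter ι), ∃ x, (fun p : Fin m => fun a => e i (j a) ((S i)^[p] x)) = w := by
    intro w
    simpa only [Prod.forall, funext_iff, limitHomeo_iterate_apply, apply_iterate_index hs] using
      exists_mem_limitSpace_iff (U := U) (e := e)
        (fun q : Fin m × Fin k => s^[q.1] (j q.2)) fun q => w q.1 q.2
  have hiff : ∀ w : Fin m → Fin k → Bool, ∀ᶠ i in (U : Filter ι),
      ((∃ x, (fun p : Fin m => fun a => e i (j a) ((S i)^[p] x)) = w) ↔
        ∃ y, (fun p : Fin m => fun a => ((limitHomeo U hs)^[p] y).1 (j a)) = w) := fun w =>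
    eventually_iff_of_imp (hword w).1 fun h => Ultrafilter.eventually_not.2 (mt (hword w).2 h)
  filter_upwards [eventually_all.2 hiff] with i hi using Set.ext hi

theorem eventually_pattern_eq (hs : ∀ i j x, e i (s j) x = e i j (S i x)) (hw : HasWitnesses e S)
    (m d : ℕ) {k : ℕ} (j : Fin k → J) :
    ∀ᶠ i in (U : Filter ι), pattern (S i) m d (fun x a => e i (j a) x) =
      pattern (limitHomeo U hs) m d (fun y a => y.1 (j a)) := by
  induction d generalizing k with
  | zero => exact eventually_pattern_zero_eq hs m j
  | succ d ih =>
    let coord : J → C(limitSpace U e, Bool) := fun b =>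
      ⟨fun y => y.1 b, (continuous_apply b).comp continuous_subtype_val⟩
    have hiff : ∀ t : Pattern m d ((Fin k → Bool) × Bool), ∀ᶠ i in (U : Filter ι),
        ((∃ Q : C(X i, Bool), pattern (S i) m d (fun x => (fun a => e i (j a) x, Q x)) = t) ↔
          ∃ Q : C(limitSpace U e, Bool),
            pattern (limitHomeo U hs) m d (fun y => (fun a => y.1 (j a), Q y)) = t) := by
      refine fun t => eventually_iff_of_imp ?_ fun hlim => ?_
      · rintro ⟨Q, rfl⟩
        obtain ⟨l, c, f, hf⟩ := exists_eq_comp_finite_tuple (c := coord)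
          (fun y y' h => Subtype.ext (funext h)) Q
        have hfc : ∀ y : limitSpace U e, (f fun a => y.1 (c a)) = Q y := fun y => (hf y).symm
        filter_upwards [ih (Fin.append j c)] with i hi
        have := pattern_comp hi fun z =>
          ((fun a => z (Fin.castAdd l a)), f fun a => z (Fin.natAdd k a))
        simp only [Fin.append_left, Fin.append_right, hfc] at this
        exact ⟨⟨fun x => f fun a => e i (c a) x,
          (continuous_of_discreteTopology (f := f)).comp (by fun_prop)⟩, this⟩
      · obtain ⟨b, hb⟩ := hw k m d j t
        filter_upwards [ih (Fin.snoc j b : Fin (k + 1) → J)] with i hi hX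
        have := pattern_comp hi fun z => ((fun a => z (Fin.castSucc a)), z (Fin.last k))
        simp only [Fin.snoc_castSucc, Fin.snoc_last] at this
        exact hlim ⟨coord b, this.symm.trans (hb i hX)⟩
    filter_upwards [eventually_all.2 hiff] with i hi using Set.ext hi

theorem exists_countable_witnessed_family (S : ∀ i, X i ≃ₜ X i) (a : ∀ i, C(X i, Bool)) :
    ∃ J : Set (∀ i, C(X i, Bool)), J.Countable ∧ a ∈ J ∧
      (∃ s : J ≃ J, ∀ i j x, (s j).1 i x = j.1 i (S i x)) ∧
        HasWitnesses (fun i (j : J) => j.1 i) S := by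
  let witness : ∀ k, (Σ m d, Pattern m d ((Fin k → Bool) × Bool)) →
      (Fin k → ∀ i, C(X i, Bool)) → ∀ i, C(X i, Bool) := fun k t v i =>
    Classical.epsilon fun Q : C(X i, Bool) =>
      pattern (S i) t.1 t.2.1 (fun x => (fun a => v a i x, Q x)) = t.2.2
  have hPattern : ∀ k m d, Countable (Pattern m d ((Fin k → Bool) × Bool)) := fun k m d =>
    Finite.to_countable
  obtain ⟨J, hJ, haJ, hop⟩ := exists_countable_closed
    (F := fun k => (Σ m d, Pattern m d ((Fin k → Bool) × Bool)) ⊕ (Fin k × Bool))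
    (fun k => Sum.elim (witness k) fun p v i =>
      (v p.1 i).comp (if p.2 then (S i : C(X i, X i)) else ((S i).symm : C(X i, X i)))) a
  have hcomp : ∀ j : J, (fun i => (j.1 i).comp (S i : C(X i, X i))) ∈ J := fun j =>
    hop 1 (.inr (0, true)) (fun _ => j.1) fun _ => j.2
  have hcomp_symm : ∀ j : J, (fun i => (j.1 i).comp ((S i).symm : C(X i, X i))) ∈ J := fun j =>
    hop 1 (.inr (0, false)) (fun _ => j.1) fun _ => j.2
  let s : J ≃ J :=
    { toFun j := ⟨_, hcomp j⟩
      invFun j := ⟨_, hcomp_symm j⟩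
      left_inv j := by
        ext i x
        exact congrArg (j.1 i) ((S i).apply_symm_apply x)
      right_inv j := by
        ext i x
        exact congrArg (j.1 i) ((S i).symm_apply_apply x) }
  refine ⟨J, hJ, haJ, ⟨s, fun i j x => rfl⟩, fun k m d j t => ?_⟩
  exact ⟨⟨_, hop k (.inl ⟨m, d, t⟩) (fun a => (j a).1) fun a => (j a).2⟩, fun i hi =>
    Classical.epsilon_spec hi⟩

end Limit

/-! ### Brouwer's characterization of the Cantor set -/

section Brouwer

variable {X Y : Type*} [TopologicalSpace X] [TopologicalSpace Y]

instance : PerfectSpace Cantor := by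
  refine perfectSpace_iff_forall_not_isolated.2 fun x => neBot_iff.2 fun hx => ?_
  obtain ⟨F, u, hu, huF⟩ := isOpen_pi_iff.1 (isOpen_singleton_iff_punctured_nhds x |>.2 hx) x rfl
  obtain ⟨i, hi⟩ := Infinite.exists_notMem_finset F
  have hflip : Function.update x i (!x i) = x := huF fun j hj => by
    rw [Function.update_of_ne (ne_of_mem_of_not_mem hj hi)]
    exact (hu j hj).2
  simpa using congrFun hflip i

theorem exists_continuousMap_bool_ne [TotallySeparatedSpace X] {x y : X} (h : x ≠ y) :
    ∃ Q : C(X, Bool), Q x ≠ Q y := by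
  obtain ⟨D, hD, hx, hy⟩ := exists_isClopen_of_totally_separated h
  obtain ⟨Q, hQ⟩ := exists_continuousMap_eq_true_iff hD
  exact ⟨Q, fun hxy => hy ((hQ y).1 (hxy ▸ (hQ x).2 hx))⟩

theorem exists_splitting [TotallySeparatedSpace X] [PerfectSpace X] {O : Set X} (hO : IsOpen O)
    (hne : O.Nonempty) : ∃ Q : C(X, Bool), ∀ b, ∃ x ∈ O, Q x = b := by
  obtain ⟨x, hx⟩ := hne
  obtain ⟨y, hy, hyx⟩ := accPt_iff_nhds.1 (PerfectSpace.univ_preperfect x (mem_univ x)) O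
    (hO.mem_nhds hx)
  obtain ⟨Q, hQ⟩ := exists_continuousMap_bool_ne hyx
  refine ⟨Q, fun b => ?_⟩
  by_cases hb : Q x = b
  · exact ⟨x, hx, hb⟩
  · exact ⟨y, hy.1, (Bool.eq_not_of_ne hQ).trans (Bool.eq_not_of_ne (Ne.symm hb)).symm⟩

theorem perfectSpace_of_pattern_eq [TotallySeparatedSpace X] [PerfectSpace X] [T1Space Y]
    {S : X ≃ₜ X} {T : Y ≃ₜ Y}
    (h : pattern S 1 2 (fun _ => ()) = pattern T 1 2 (fun _ => ())) : PerfectSpace Y := by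
  -- The clopen set matching an isolated point of `Y` could be split into two nonempty pieces in
  -- `X`, but not in `Y`.
  refine perfectSpace_iff_forall_not_isolated.2 fun y => neBot_iff.2 fun hy => ?_
  have hclopen : IsClopen {y} :=
    ⟨isClosed_singleton, (isOpen_singleton_iff_punctured_nhds y).2 hy⟩
  obtain ⟨Q', hQ'⟩ := exists_continuousMap_eq_true_iff hclopen
  obtain ⟨Q, hQ⟩ := (pattern_succ_eq_iff.1 h).2 Q'
  have hQne : (Q ⁻¹' {true}).Nonempty := by
    obtain ⟨x, hx⟩ := (pattern_zero_eq_iff.1 (pattern_eq_of_rank_le (Nat.zero_le 1) hQ)).2 y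
    exact ⟨x, (congrArg Prod.snd (hx 0)).trans ((hQ' y).2 rfl)⟩
  obtain ⟨E, hE⟩ := exists_splitting ((isOpen_discrete {true}).preimage Q.continuous) hQne
  obtain ⟨E', hEE'⟩ := (pattern_succ_eq_iff.1 hQ).1 E
  have hall : ∀ b, E' y = b := fun b => by
    obtain ⟨x, hxQ, hxE⟩ := hE b
    obtain ⟨z, hz⟩ := (pattern_zero_eq_iff.1 hEE').1 x
    obtain ⟨hzQ, hzE⟩ : Q x = Q' z ∧ E x = E' z := by simpa using hz 0
    obtain rfl : z = y := (hQ' z).1 (hzQ.symm.trans hxQ)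
    exact hzE.symm.trans hxE
  exact absurd ((hall true).symm.trans (hall false)) (by decide)

variable [CompactSpace Y] [T2Space Y] [TotallyDisconnectedSpace Y]

theorem countable_continuousMap_bool [SecondCountableTopology Y] : Countable C(Y, Bool) := by
  have : Countable (TopologicalSpace.Clopens Y) :=
    TopologicalSpace.Clopens.countable_iff_secondCountable.2 inferInstance
  let support (Q : C(Y, Bool)) : TopologicalSpace.Clopens Y :=
    ⟨Q ⁻¹' {true}, (isClopen_discrete _).preimage Q.continuous⟩
  refine Function.Injective.countable (f := support) fun Q Q' h => ContinuousMap.ext fun y => ?_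
  exact Bool.eq_iff_iff.2 (Set.ext_iff.1 (congrArg SetLike.coe h) y)

theorem exists_surjective_refinement [PerfectSpace Y] {V : Type*} [TopologicalSpace V]
    [DiscreteTopology V] (h : C(Y, V)) (hh : Function.Surjective h) (c : C(Y, Bool)) :
    ∃ q : C(Y, Bool), (Function.Surjective fun y => (h y, q y)) ∧
      ∀ y y', h y = h y' → q y = q y' → c y = c y' := by
  have hcell : ∀ v, ∃ q : C(Y, Bool), (∀ b, ∃ y, h y = v ∧ q y = b) ∧
      ∀ y y', h y = v → h y' = v → q y = q y' → c y = c y' := fun v => by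
    by_cases hc : ∀ b, ∃ y, h y = v ∧ c y = b
    · exact ⟨c, hc, fun _ _ _ _ => id⟩
    obtain ⟨q, hq⟩ := exists_splitting ((isOpen_discrete {v}).preimage h.continuous) (hh v)
    push Not at hc
    obtain ⟨b, hb⟩ := hc
    refine ⟨q, hq, fun y y' hy hy' _ => ?_⟩
    rw [Bool.eq_not_of_ne (hb y hy), Bool.eq_not_of_ne (hb y' hy')]
  choose q hsurj hrefine using hcell
  refine ⟨⟨fun y => q (h y) y, ?_⟩, fun ⟨v, b⟩ => ?_, fun y y' hy hq => ?_⟩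
  · exact ((continuous_of_discreteTopology (f := q)).comp h.continuous).eval continuous_id
  · obtain ⟨y, rfl, hy⟩ := hsurj v b
    exact ⟨y, congrArg (Prod.mk _) hy⟩
  · exact hrefine (h y') y y' hy rfl (by simpa [hy] using hq)

theorem exists_independent_separating_sequence [PerfectSpace Y] [SecondCountableTopology Y]
    [Nonempty Y] : ∃ q : ℕ → C(Y, Bool), (∀ y y', (∀ n, q n y = q n y') → y = y') ∧
      ∀ n (b : Fin n → Bool), ∃ y, ∀ i : Fin n, q i y = b i := by
  have := countable_continuousMap_bool (Y := Y)
  obtain ⟨c, hc⟩ := exists_surjective_nat C(Y, Bool)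
  choose next hsurj hrefine using
    fun n (h : {h : C(Y, Fin n → Bool) // Function.Surjective h}) =>
      exists_surjective_refinement h.1 h.2 (c n)
  let h (n : ℕ) : {h : C(Y, Fin n → Bool) // Function.Surjective h} :=
    n.rec ⟨ContinuousMap.const Y default, fun b => ⟨Classical.arbitrary Y, Subsingleton.elim _ _⟩⟩
      fun n h => ⟨⟨fun y => Fin.snoc (h.1 y) (next n h y),
        h.1.continuous.finSnoc (next n h).continuous⟩, fun b => by
          obtain ⟨y, hy⟩ := hsurj n h (Fin.init b, b (Fin.last n))
          refine ⟨y, ?_⟩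
          simp only [Prod.mk.injEq] at hy
          simp [hy.1, hy.2]⟩
  let q (n : ℕ) : C(Y, Bool) := next n (h n)
  have hq : ∀ n y (i : Fin n), (h n).1 y i = q i y := by
    intro n y
    induction n with
    | zero => exact fun i => i.elim0
    | succ n ih => exact Fin.lastCases (Fin.snoc_last (α := fun _ => Bool) _ _) fun i =>
        (Fin.snoc_castSucc (α := fun _ => Bool) _ _ i).trans (ih i)
  refine ⟨q, fun y y' hyy' => by_contra fun hne => ?_, fun n b => ?_⟩
  · obtain ⟨Q, hQ⟩ := exists_continuousMap_bool_ne hne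
    obtain ⟨n, rfl⟩ := hc Q
    exact hQ (hrefine n (h n) y y' (funext fun i => by simp only [hq, hyy']) (hyy' n))
  · obtain ⟨y, hy⟩ := (h n).2 b
    exact ⟨y, fun i => (hq n y i).symm.trans (congrFun hy i)⟩

theorem nonempty_homeomorph_cantor [PerfectSpace Y] [SecondCountableTopology Y] [Nonempty Y] :
    Nonempty (Y ≃ₜ Cantor) := by
  obtain ⟨q, hsep, hind⟩ := exists_independent_separating_sequence (Y := Y)
  let f : Y → Cantor := fun y n => q n y
  have hf : Continuous f := by fun_prop
  have hclosed : ∀ {b : Cantor} n, IsClosed {y | ∀ i : Fin n, q i y = b i} := fun n => by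
    simp only [ofPred_forall]
    exact isClosed_iInter fun i => isClosed_eq (by fun_prop) continuous_const
  have hsurj : Function.Surjective f := fun b => by
    obtain ⟨y, hy⟩ := IsCompact.nonempty_iInter_of_sequence_nonempty_isCompact_isClosed
      (fun n => {y | ∀ i : Fin n, q i y = b i})
      (fun n y hy i => hy i.castSucc) (fun n => hind n fun i => b i)
      (hclosed 0).isCompact hclosed
    exact ⟨y, funext fun n => mem_iInter.1 hy (n + 1) (Fin.last n)⟩
  have hinj : Function.Injective f := fun y y' h => hsep y y' (congrFun h)
  exact ⟨hf.homeoOfEquivCompactToT2 (f := Equiv.ofBijective f ⟨hinj, hsurj⟩)⟩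

end Brouwer

theorem exists_cantor_limit {ι : Type*} (U : Ultrafilter ι) {X : ι → Type*}
    [∀ i, TopologicalSpace (X i)] [∀ i, Nonempty (X i)] [∀ i, TotallySeparatedSpace (X i)]
    [∀ i, PerfectSpace (X i)] (S : ∀ i, X i ≃ₜ X i) (a : ∀ i, C(X i, Bool)) :
    ∃ (τ : Cantor ≃ₜ Cantor) (b : C(Cantor, Bool)),
      ∀ m d, ∀ᶠ i in (U : Filter ι), pattern (S i) m d (a i) = pattern τ m d b := by
  obtain ⟨J, hJ, haJ, ⟨s, hs⟩, hw⟩ := exists_countable_witnessed_family S a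
  have := hJ.to_subtype
  let Y := limitSpace U fun i (j : J) => j.1 i
  let T : Y ≃ₜ Y := limitHomeo U hs
  have hpattern : ∀ m d {k : ℕ} (j : Fin k → J), ∀ᶠ i in (U : Filter ι),
      pattern (S i) m d (fun x c => (j c).1 i x) = pattern T m d fun y c => y.1 (j c) :=
    fun m d k j => eventually_pattern_eq hs hw m d j
  have : Nonempty Y := ((exists_mem_limitSpace_iff Fin.elim0 Fin.elim0).2
    (Eventually.of_forall fun i => ⟨Classical.arbitrary (X i), fun a => a.elim0⟩)).nonempty
  have : PerfectSpace Y := by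
    obtain ⟨i, hi⟩ := (hpattern 1 2 Fin.elim0).exists
    exact perfectSpace_of_pattern_eq (pattern_comp hi fun _ => ())
  obtain ⟨g⟩ := nonempty_homeomorph_cantor (Y := Y)
  let b : C(Y, Bool) := ⟨fun y => y.1 ⟨a, haJ⟩, (continuous_apply _).comp continuous_subtype_val⟩
  refine ⟨(g.symm.trans T).trans g, b.comp (g.symm : C(Cantor, Y)), fun m d => ?_⟩
  filter_upwards [hpattern m d fun _ : Fin 1 => ⟨a, haJ⟩] with i hi
  rw [← pattern_conj (S := T) g (by simp)]
  simpa [b] using pattern_comp hi fun z => z 0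

/-! ### Homeomorphism groups -/

theorem isClosedEmbedding_homeo {X : Type*} [TopologicalSpace X] [LocallyCompactSpace X]
    [T2Space X] :
    IsClosedEmbedding fun f : X ≃ₜ X => ((f : C(X, X)), (f.symm : C(X, X))) := by
  refine ⟨⟨⟨rfl⟩, fun f g h => Homeomorph.ext fun x => DFunLike.congr_fun (Prod.ext_iff.1 h).1 x⟩,
    ?_⟩
  have hrange : range (fun f : X ≃ₜ X => ((f : C(X, X)), (f.symm : C(X, X)))) =
      {p | p.1.comp p.2 = ContinuousMap.id X} ∩ {p | p.2.comp p.1 = ContinuousMap.id X} := by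
    ext ⟨f, g⟩
    constructor
    · rintro ⟨h, hh⟩
      obtain ⟨rfl, rfl⟩ := Prod.ext_iff.1 hh
      exact ⟨ContinuousMap.ext h.apply_symm_apply, ContinuousMap.ext h.symm_apply_apply⟩
    · rintro ⟨h₁, h₂⟩
      exact ⟨⟨⟨f, g, DFunLike.congr_fun h₂, DFunLike.congr_fun h₁⟩, f.continuous,
        g.continuous⟩, rfl⟩
  rw [hrange]
  exact (isClosed_eq (continuous_fst.compCM continuous_snd) continuous_const).inter
    (isClosed_eq (continuous_snd.compCM continuous_fst) continuous_const)

instance (X : Type*) [TopologicalSpace X] [CompactSpace X]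
    [TopologicalSpace.IsCompletelyMetrizableSpace X] : BaireSpace (X ≃ₜ X) := by
  let := TopologicalSpace.upgradeIsCompletelyMetrizable X
  have := (isClosedEmbedding_homeo (X := X)).IsCompletelyMetrizableSpace
  infer_instance

theorem continuous_homeo_iterate {X : Type*} [TopologicalSpace X] [LocallyCompactSpace X]
    [T2Space X] (k : ℕ) :
    Continuous fun f : X ≃ₜ X => (⟨f^[k], f.continuous.iterate k⟩ : C(X, X)) := by
  have hcoe : Continuous fun f : X ≃ₜ X => (f : C(X, X)) :=
    continuous_fst.comp (isClosedEmbedding_homeo (X := X)).continuous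
  induction k with
  | zero => exact continuous_const (y := ContinuousMap.id X)
  | succ k ih => exact ih.compCM hcoe

/-! ### Return times -/

section ReturnTimes

variable {X Y : Type*} [TopologicalSpace X] [TopologicalSpace Y]

/-- The set of `k` such that some point of the clopen set `a` returns to `a` at time `k + 1`. -/
def returnTimes (S : X ≃ₜ X) (a : C(X, Bool)) : Set ℕ :=
  {k | ∃ x, a x = true ∧ a (S^[k + 1] x) = true}

theorem mem_returnTimes_of_pattern_eq {S : X ≃ₜ X} {T : Y ≃ₜ Y} {a : C(X, Bool)} {b : C(Y, Bool)}
    {k : ℕ} (h : pattern S (k + 2) 0 a = pattern T (k + 2) 0 b) (hk : k ∈ returnTimes S a) :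
    k ∈ returnTimes T b := by
  obtain ⟨x, hx, hxk⟩ := hk
  obtain ⟨y, hy⟩ := (pattern_zero_eq_iff.1 h).1 x
  exact ⟨y, (hy 0).symm.trans hx, (hy (Fin.last (k + 1))).symm.trans hxk⟩

theorem mem_returnTimes_iff_of_pattern_eq {S : X ≃ₜ X} {T : Y ≃ₜ Y} {a : C(X, Bool)}
    {b : C(Y, Bool)} {k : ℕ} (h : pattern S (k + 2) 0 a = pattern T (k + 2) 0 b) :
    k ∈ returnTimes S a ↔ k ∈ returnTimes T b :=
  ⟨mem_returnTimes_of_pattern_eq h, mem_returnTimes_of_pattern_eq h.symm⟩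

theorem returnTimes_conj {S : X ≃ₜ X} {T : Y ≃ₜ Y} (g : X ≃ₜ Y) (hg : ∀ x, g (S x) = T (g x))
    (a : C(Y, Bool)) : returnTimes S (a.comp (g : C(X, Y))) = returnTimes T a :=
  ext fun _ => mem_returnTimes_iff_of_pattern_eq (pattern_conj g hg a)

theorem isClopen_setOf_mem_returnTimes [CompactSpace X] [T2Space X] (a : C(X, Bool)) (k : ℕ) :
    IsClopen {S : X ≃ₜ X | k ∈ returnTimes S a} := by
  suffices IsClopen {f : C(X, X) | ∃ x, a x = true ∧ a (f x) = true} from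
    this.preimage (continuous_homeo_iterate (k + 1))
  constructor
  · rw [← isOpen_compl_iff]
    convert ContinuousMap.isOpen_setOfPred_mapsTo
      ((isClosed_discrete {true}).preimage a.continuous).isCompact
      ((isOpen_discrete {false}).preimage a.continuous) using 1
    ext f
    simp [MapsTo]
  · simp only [ofPred_exists, ofPred_and]
    exact isOpen_iUnion fun x => isOpen_const.inter
      ((isOpen_discrete {true}).preimage (a.continuous.comp (continuous_eval_const x)))

theorem isOpen_setOf_returnTimes_agree [CompactSpace X] [T2Space X] (a : C(X, Bool)) (A : Set ℕ)
    (m : ℕ) : IsOpen {S : X ≃ₜ X | ∀ k < m, (k ∈ returnTimes S a ↔ k ∈ A)} := by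
  simp only [ofPred_forall]
  refine (finite_lt_nat m).isOpen_biInter fun k _ => ?_
  by_cases hk : k ∈ A
  · simpa only [hk, iff_true] using (isClopen_setOf_mem_returnTimes a k).isOpen
  · simp only [hk, iff_false]
    exact (isClopen_setOf_mem_returnTimes a k).compl.isOpen

theorem exists_not_returnTimes [Countable C(X, Bool)] (S : X ≃ₜ X) :
    ∃ A, ∀ a, returnTimes S a ≠ A := by
  have : Nonempty C(X, Bool) := ⟨.const X true⟩
  obtain ⟨f, hf⟩ := exists_surjective_nat C(X, Bool)
  by_contra! h
  exact Function.cantor_surjective (returnTimes S ∘ f) (.comp h hf)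

end ReturnTimes

/-- The two-sided full shift. -/
def fullShift : (ℤ → Bool) ≃ₜ (ℤ → Bool) where
  toFun y i := y (i + 1)
  invFun y i := y (i - 1)
  left_inv y := by simp
  right_inv y := by simp
  continuous_toFun := by fun_prop
  continuous_invFun := by fun_prop

theorem fullShift_iterate_apply (k : ℕ) (y : ℤ → Bool) (i : ℤ) :
    fullShift^[k] y i = y (i + k) := by
  induction k generalizing y with
  | zero => simp
  | succ k ih =>
    rw [Function.iterate_succ_apply, ih, Nat.cast_succ, ← add_assoc]
    rfl

theorem exists_fullShift_returnTimes_agree (A : Set ℕ) (m : ℕ) :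
    ∃ a, ∀ k < m, (k ∈ returnTimes fullShift a ↔ k ∈ A) := by
  -- Within the cylinder `y 0 = true`, forbid returns at the times outside `A`. The sequence which
  -- is `true` exactly at `0` and `k + 1` still returns at time `k + 1` if `k ∈ A`.
  have hclopen : IsClopen {y : ℤ → Bool | ∀ k < m, k ∉ A → y (k + 1) = false} := by
    simp only [ofPred_forall]
    exact (finite_lt_nat m).isClopen_biInter fun k _ => isClopen_iInter_of_finite fun _ =>
      (isClopen_discrete {false}).preimage (continuous_apply ((k : ℤ) + 1))
  obtain ⟨a, ha⟩ : ∃ a : C(ℤ → Bool, Bool), ∀ y, a y = true ↔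
      y 0 = true ∧ ∀ k < m, k ∉ A → y (k + 1) = false :=
    exists_continuousMap_eq_true_iff
      (((isClopen_discrete {true}).preimage (continuous_apply 0)).inter hclopen)
  refine ⟨a, fun k hk => ⟨fun ⟨y, hy, hyk⟩ => by_contra fun hkA => ?_, fun hkA =>
    ⟨fun i => decide (i = 0 ∨ i = k + 1), (ha _).2 ⟨by simp, fun l _ hlA => ?_⟩,
      (ha _).2 ⟨by simp [fullShift_iterate_apply, -Function.iterate_succ], fun l _ _ => ?_⟩⟩⟩⟩
  · have hy_false := ((ha y).1 hy).2 k hk hkA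
    have hy_true := ((ha _).1 hyk).1
    rw [fullShift_iterate_apply, zero_add, Nat.cast_succ, hy_false] at hy_true
    exact Bool.false_ne_true hy_true
  · have hlk : l ≠ k := ne_of_mem_of_not_mem hkA hlA |>.symm
    exact decide_eq_false (by omega)
  · rw [fullShift_iterate_apply]
    exact decide_eq_false (by omega)

theorem exists_returnTimes_agree_of_dense {σ : Cantor ≃ₜ Cantor}
    (hσ : Dense {τ : Cantor ≃ₜ Cantor | TopConj σ τ}) (A : Set ℕ) (m : ℕ) :
    ∃ a, ∀ k < m, (k ∈ returnTimes σ a ↔ k ∈ A) := by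
  let e : (ℤ → Bool) ≃ₜ Cantor := Homeomorph.piCongrLeft (Y := fun _ => Bool) Equiv.intEquivNat
  let shift : Cantor ≃ₜ Cantor := (e.symm.trans fullShift).trans e
  obtain ⟨a, ha⟩ := exists_fullShift_returnTimes_agree A m
  let b : C(Cantor, Bool) := a.comp (e.symm : C(Cantor, ℤ → Bool))
  have hshift : returnTimes shift b = returnTimes fullShift a :=
    returnTimes_conj e.symm (fun x => by simp [shift]) a
  obtain ⟨τ, hτ, g, hg⟩ := hσ.inter_open_nonempty _ (isOpen_setOf_returnTimes_agree b A m)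
    ⟨shift, fun k hk => by rw [hshift, ha k hk]⟩
  exact ⟨b.comp (g : C(Cantor, Cantor)), fun k hk => by rw [returnTimes_conj g hg, hτ k hk]⟩

theorem exists_homeo_pattern_eq_returnTimes {S : Cantor ≃ₜ Cantor} {A : Set ℕ}
    (hA : ∀ m, ∃ a, ∀ k < m, (k ∈ returnTimes S a ↔ k ∈ A)) :
    ∃ τ : Cantor ≃ₜ Cantor,
      (∀ m d, pattern S m d (fun _ => ()) = pattern τ m d (fun _ => ())) ∧
      ∃ b, returnTimes τ b = A := by
  choose a ha using hA
  obtain ⟨τ, b, hτ⟩ := exists_cantor_limit (hyperfilter ℕ) (fun _ => S) a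
  refine ⟨τ, fun m d => ?_, b, ext fun k => ?_⟩
  · obtain ⟨n, hn⟩ := (hτ m d).exists
    exact pattern_comp hn fun _ => ()
  · have hlarge : ∀ᶠ n in (hyperfilter ℕ : Filter ℕ), k < n :=
      Nat.hyperfilter_le_atTop (eventually_gt_atTop k)
    obtain ⟨n, hn, hkn⟩ := ((hτ (k + 2) 0).and hlarge).exists
    exact (mem_returnTimes_iff_of_pattern_eq hn).symm.trans (ha n k hkn)

/-! ### The type of a projection with prescribed return times -/

/-- The term `x * α^(k + 1)(x)`. At a projection of `C(X)` it is the indicator of the points that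
return at time `k + 1`. -/
def returnTerm (k : ℕ) : Term 1 :=
  .mul (.var 0) (Term.aut^[k + 1] (.var 0))

/-- The type of an idempotent whose set of return times is `A`: besides `x² - x = 0` it requires
`‖x * α^(k + 1)(x)‖` to be the value at `k` of the indicator function of `A`. -/
def returnType (A : Set ℕ) : Set (Formula 1) :=
  insert (.norm (.add (.mul (.var 0) (.var 0)) (.smul (-1) (.var 0))))
    (range fun k => .conn (k := 1) ⟨fun r => r 0 - A.indicator 1 k, by fun_prop⟩
      fun _ => .norm (returnTerm k))

section ReturnType

variable {X : Type*} [TopologicalSpace X]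

theorem exists_eq_indicator_of_isIdempotentElem {f : C(X, ℂ)} (hf : IsIdempotentElem f) :
    ∃ a : C(X, Bool), ∀ x, f x = if a x then 1 else 0 := by
  have hzero_one : ∀ x, f x = 0 ∨ f x = 1 := fun x =>
    IsIdempotentElem.iff_eq_zero_or_one.1 (DFunLike.congr_fun hf x)
  have hcompl : f ⁻¹' {1} = (f ⁻¹' {0})ᶜ := by
    ext x
    rcases hzero_one x with h | h <;> simp [h]
  have hclopen : IsClopen (f ⁻¹' {1}) :=
    ⟨isClosed_singleton.preimage f.continuous,
      hcompl ▸ (isClosed_singleton.preimage f.continuous).isOpen_compl⟩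
  obtain ⟨a, ha⟩ := exists_continuousMap_eq_true_iff hclopen
  refine ⟨a, fun x => ?_⟩
  split_ifs with h
  · exact (ha x).1 h
  · exact (hzero_one x).resolve_right (mt (ha x).2 h)

variable [CompactSpace X] (S : X ≃ₜ X)

theorem Term.aut_iterate_eval_apply {n : ℕ} (t : Term n) (k : ℕ) (v : Fin n → C(X, ℂ)) (x : X) :
    (Term.aut^[k] t).eval (inducedAut S) v x = t.eval (inducedAut S) v (S^[k] x) := by
  induction k generalizing x with
  | zero => rfl
  | succ k ih =>
    rw [Function.iterate_succ_apply', Function.iterate_succ_apply]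
    exact ih (S x)

open Classical in
theorem norm_returnTerm {f : C(X, ℂ)} {a : C(X, Bool)} (hfa : ∀ x, f x = if a x then 1 else 0)
    (k : ℕ) : ‖(returnTerm k).eval (inducedAut S) fun _ => f‖ =
      (returnTimes S a).indicator 1 k := by
  have happ : ∀ x, (returnTerm k).eval (inducedAut S) (fun _ => f) x =
      if a x = true ∧ a (S^[k + 1] x) = true then 1 else 0 := fun x => by
    change f x * (Term.aut^[k + 1] (.var 0)).eval (inducedAut S) (fun _ => f) x = _
    rw [Term.aut_iterate_eval_apply]
    change f x * f (S^[k + 1] x) = _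
    rw [hfa, hfa, ite_zero_mul_ite_zero, mul_one]
  by_cases h : k ∈ returnTimes S a
  · rw [indicator_of_mem h, Pi.one_apply]
    obtain ⟨x, hx⟩ := h
    refine le_antisymm ((ContinuousMap.norm_le _ zero_le_one).2 fun y => ?_) ?_
    · rw [happ]
      split_ifs <;> simp
    · have hle := ((returnTerm k).eval (inducedAut S) fun _ => f).norm_coe_le_norm x
      rwa [happ, if_pos hx, norm_one] at hle
  · rw [indicator_of_notMem h, norm_eq_zero]
    ext x
    rw [happ, if_neg fun hx => h ⟨x, hx⟩, ContinuousMap.zero_apply]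

theorem eval_returnType_eq_zero_iff {A : Set ℕ} {f : C(X, ℂ)} :
    (∀ φ ∈ returnType A, φ.eval (inducedAut S) (fun _ => f) = 0) ↔
      IsIdempotentElem f ∧
        ∀ k, ‖(returnTerm k).eval (inducedAut S) fun _ => f‖ = A.indicator 1 k := by
  rw [returnType, forall_mem_insert, forall_mem_range]
  refine and_congr ?_ (forall_congr' fun k => sub_eq_zero)
  change ‖f * f + (-1 : ℂ) • f‖ = 0 ↔ f * f = f
  rw [norm_eq_zero, neg_one_smul, ← sub_eq_add_neg, sub_eq_zero]

theorem realizes_returnType_iff (A : Set ℕ) :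
    Realizes (inducedAut S) (returnType A) ↔ ∃ a, returnTimes S a = A := by
  constructor
  · rintro ⟨v, hv⟩
    obtain ⟨f, rfl⟩ : ∃ f : C(X, ℂ), v = fun _ => f :=
      ⟨v 0, funext fun i => congrArg v (Subsingleton.elim i 0)⟩
    obtain ⟨hf, hnorm⟩ := (eval_returnType_eq_zero_iff S).1 hv
    obtain ⟨a, ha⟩ := exists_eq_indicator_of_isIdempotentElem hf
    refine ⟨a, indicator_one_inj ℝ (funext fun k => ?_)⟩
    exact (norm_returnTerm S ha k).symm.trans (hnorm k)
  · rintro ⟨a, rfl⟩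
    let f : C(X, ℂ) := .comp ⟨fun b : Bool => if b then 1 else 0, continuous_of_discreteTopology⟩ a
    have hfa : ∀ x, f x = if a x then 1 else 0 := fun _ => rfl
    refine ⟨fun _ => f, (eval_returnType_eq_zero_iff S).2 ⟨ContinuousMap.ext fun x => ?_,
      norm_returnTerm S hfa⟩⟩
    simp [hfa]

end ReturnType

/-! ### Invariance under isomorphism -/

section Isomorphism

variable {A B : Type*} [CStarAlgebra A] [CStarAlgebra B] {α : A ≃⋆ₐ[ℂ] A} {β : B ≃⋆ₐ[ℂ] B}

theorem Term.eval_map (Φ : A ≃⋆ₐ[ℂ] B) (hΦ : ∀ a, Φ (α a) = β (Φ a)) {n : ℕ} (t : Term n)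
    (v : Fin n → A) : t.eval β (fun i => Φ (v i)) = Φ (t.eval α v) := by
  induction t with
  | var i => rfl
  | one => exact (map_one Φ).symm
  | add s t hs ht => simp only [eval, hs, ht, map_add]
  | mul s t hs ht => simp only [eval, hs, ht, map_mul]
  | smul c t ht => simp only [eval, ht, map_smul]
  | star t ht => simp only [eval, ht, map_star]
  | aut t ht => simp only [eval, ht, hΦ]

theorem Formula.eval_map (Φ : A ≃⋆ₐ[ℂ] B) (hΦ : ∀ a, Φ (α a) = β (Φ a)) {n : ℕ} (φ : Formula n)
    (v : Fin n → A) : φ.eval β (fun i => Φ (v i)) = φ.eval α v := by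
  have hnorm : ∀ a, ‖Φ a‖ = ‖a‖ := fun a => NonUnitalStarAlgHom.norm_map Φ Φ.injective a
  let ball : ∀ r : ℕ, Metric.closedBall (0 : A) (r : ℝ) ≃ Metric.closedBall (0 : B) (r : ℝ) :=
    fun r => Φ.toEquiv.subtypeEquiv fun a => by
      rw [mem_closedBall_zero_iff, mem_closedBall_zero_iff]
      exact iff_of_eq (congrArg (· ≤ (r : ℝ)) (hnorm a).symm)
  have hsnoc : ∀ {n r : ℕ} (v : Fin n → A) (x : Metric.closedBall (0 : A) (r : ℝ)),
      (Fin.snoc (fun i => Φ (v i)) (ball r x : B) : Fin (n + 1) → B) =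
        fun i => Φ ((Fin.snoc v (x : A) : Fin (n + 1) → A) i) := by
    intro n r v x
    funext i
    refine Fin.lastCases ?_ (fun j => ?_) i
    · simp only [Fin.snoc_last]; rfl
    · simp only [Fin.snoc_castSucc]
  induction φ with
  | norm t => simp only [eval, t.eval_map Φ hΦ, hnorm]
  | conn u φ ih => simp only [eval, ih]
  | sup r φ ih =>
    simp only [eval]
    rw [← (ball r).iSup_comp]
    simp only [hsnoc, ih]
  | inf r φ ih =>
    simp only [eval]
    rw [← (ball r).iInf_comp]
    simp only [hsnoc, ih]

theorem Isomorphic.realizes (h : Isomorphic α β) {n : ℕ} {p : Set (Formula n)}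
    (hp : Realizes α p) : Realizes β p := by
  obtain ⟨Φ, hΦ⟩ := h
  obtain ⟨v, hv⟩ := hp
  exact ⟨fun i => Φ (v i), fun φ hφ => (φ.eval_map Φ hΦ v).trans (hv φ hφ)⟩

end Isomorphism

end CantorDynamics

end

open CantorDynamics in
theorem corollary3p6_general (σ : Cantor ≃ₜ Cantor)
    (hσ : Dense {τ : Cantor ≃ₜ Cantor | TopConj σ τ}) :
    ¬ SeparablyCategorical (theory (inducedAut σ)) ∧
    ∃ τ : Cantor ≃ₜ Cantor,
      Models (inducedAut τ) (theory (inducedAut σ)) ∧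
      (∃ (n : ℕ) (p : Set (Formula n)),
        ¬ Realizes (inducedAut σ) p ∧ Realizes (inducedAut τ) p) ∧
      ¬ TopConj σ τ := by
  have := countable_continuousMap_bool (Y := Cantor)
  obtain ⟨A, hA⟩ := exists_not_returnTimes σ
  obtain ⟨τ, hτ, b, hb⟩ :=
    exists_homeo_pattern_eq_returnTimes (exists_returnTimes_agree_of_dense hσ A)
  have hmodels : Models (inducedAut τ) (theory (inducedAut σ)) :=
    models_theory_of_pattern_eq fun N => hτ N N
  have homits : ¬ Realizes (inducedAut σ) (returnType A) := fun h =>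
    have ⟨a, ha⟩ := (realizes_returnType_iff σ A).1 h
    hA a ha
  have hrealizes : Realizes (inducedAut τ) (returnType A) :=
    (realizes_returnType_iff τ A).2 ⟨b, hb⟩
  refine ⟨fun hcat => homits ?_, τ, hmodels, ⟨1, _, homits, hrealizes⟩, fun ⟨g, hg⟩ =>
    hA _ ((returnTimes_conj g hg b).trans hb)⟩
  exact (hcat _ _ (inducedAut τ) (inducedAut σ) hmodels fun _ hφ => hφ).realizes hrealizes

theorem corollary3p6 (σ : CantorDynamics.Cantor ≃ₜ CantorDynamics.Cantor)
    (hσ : CantorDynamics.IsGeneric σ) :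
    ¬ CantorDynamics.SeparablyCategorical
        (CantorDynamics.theory (CantorDynamics.inducedAut σ)) ∧
    ∃ τ : CantorDynamics.Cantor ≃ₜ CantorDynamics.Cantor,
      CantorDynamics.Models (CantorDynamics.inducedAut τ)
        (CantorDynamics.theory (CantorDynamics.inducedAut σ)) ∧
      (∃ (n : ℕ) (p : Set (CantorDynamics.Formula n)),
        ¬ CantorDynamics.Realizes (CantorDynamics.inducedAut σ) p ∧
        CantorDynamics.Realizes (CantorDynamics.inducedAut τ) p) ∧
      ¬ CantorDynamics.TopConj σ τ :=
  corollary3p6_general σ (dense_of_mem_residual hσ)
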